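/- **Theorem 2.1.** Let $K$ be a field, let $n, m$ be non-negative integers, and let $G$ be a finite simple graph on the vertex set $[n]=\{1,\dots,n\}$ that is chordal, i.e. every cycle of $G$ of length greater than $3$ has a chord (an edge of $G$ that joins two vertices of the cycle and is not an edge of the cycle). Call the maximal cliques of $G$ facets (they are the facets of the clique complex $\Delta(G)$), and call a vertex of a facet free if it belongs to no other facet. Let $F_1,\dots,F_m$ be the facets that contain a free vertex, listed without repetition. For a field $k$, let $I_k(G)\subset k[x_1,\dots,x_n]$ be the edge ideal of $G$, generated by the monomials $x_ix_j$ with $\{i,j\}$ an edge of $G$; $G$ is called Cohen–Macaulay over $k$ if $k[x_1,\dots,x_n]/I_k(G)$ is a Cohen–Macaulay ring, i.e. a Noetherian ring all of whose localizations at maximal ideals have depth equal to their Krull dimension. Then the following conditions are equivalent: (a) $G$ is Cohen–Macaulay, i.e. Cohen–Macaulay over every field; (b) $G$ is Cohen–Macaulay over $K$; (c) $G$ is unmixed, i.e. all minimal vertex covers of $G$ have the same cardinality; (d) $[n]$ is the disjoint union of $F_1,\dots,F_m$. Moreover, if (d) holds, then with $S=K[x_1,\dots,x_n]$ and $y_i=\sum_{j\in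 F_i}x_j$ for $i=1,\dots,m$, the sequence $y_1,\dots,y_m$ is a regular sequence on $S/I_K(G)$, and $\dim S/I_K(G)=m$. -/

import Mathlib

open MvPolynomial

universe u v

namespace CohenMacaulayChordal

/-! ### Cohen-Macaulay rings -/

/-- The depth of a local ring: the supremum of the lengths of the regular sequences in the ring
(over a local ring the members of a regular sequence are automatically in the maximal ideal,
because the quotient by them is required to be nonzero). -/
noncomputable def depth (R : Type u) [CommRing R] [IsLocalRing R] : ℕ∞ :=
  ⨆ rs : {rs : List R // RingTheory.Sequence.IsRegular R rs}, (rs.1.length : ℕ∞)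

/-- A Noetherian local ring is Cohen-Macaulay if its depth equals its Krull dimension. -/
def IsCohenMacaulayLocalRing (R : Type u) [CommRing R] [IsLocalRing R] : Prop :=
  IsNoetherianRing R ∧ (depth R : WithBot ℕ∞) = ringKrullDim R

/-- A Noetherian ring is Cohen-Macaulay if its localizations at all maximal ideals are
Cohen-Macaulay local rings. -/
def IsCohenMacaulayRing (R : Type u) [CommRing R] : Prop :=
  IsNoetherianRing R ∧
    ∀ (p : Ideal R) [p.IsMaximal], IsCohenMacaulayLocalRing (Localization.AtPrime p)

/-! ### Graphs -/

variable {n : ℕ}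

/-- A graph is chordal if every cycle of length greater than three has a chord: an edge of the
graph that joins two vertices of the cycle and is not an edge of the cycle. -/
def IsChordal (G : SimpleGraph (Fin n)) : Prop :=
  ∀ (a : Fin n) (c : G.Walk a a), c.IsCycle → 3 < c.length →
    ∃ x ∈ c.support, ∃ y ∈ c.support, G.Adj x y ∧ s(x, y) ∉ c.edges

/-- The facets of the clique complex of `G`: the maximal cliques of `G`. -/
def IsFacet (G : SimpleGraph (Fin n)) (F : Finset (Fin n)) : Prop :=
  Maximal (fun s : Finset (Fin n) => G.IsClique (s : Set (Fin n))) F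

/-- `x` is a free vertex of `F` if `F` is the only facet that contains `x`. -/
def IsFreeVertex (G : SimpleGraph (Fin n)) (F : Finset (Fin n)) (x : Fin n) : Prop :=
  x ∈ F ∧ ∀ F' : Finset (Fin n), IsFacet G F' → x ∈ F' → F' = F

/-- Minimal vertex covers of `G`. -/
def IsMinimalVertexCover (G : SimpleGraph (Fin n)) (C : Finset (Fin n)) : Prop :=
  Minimal (fun s : Finset (Fin n) => G.IsVertexCover (s : Set (Fin n))) C

/-- A graph is unmixed if all its minimal vertex covers have the same cardinality. -/
def IsUnmixed (G : SimpleGraph (Fin n)) : Prop :=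
  ∀ C D : Finset (Fin n), IsMinimalVertexCover G C → IsMinimalVertexCover G D → C.card = D.card

/-! ### Edge ideals -/

/-- The edge ideal of `G` in `K[x_1, …, x_n]`, generated by the monomials `x_i x_j` for the
edges `{i, j}` of `G`. -/
noncomputable def edgeIdeal (K : Type u) [Field K] (G : SimpleGraph (Fin n)) :
    Ideal (MvPolynomial (Fin n) K) :=
  Ideal.span {f | ∃ i j : Fin n, G.Adj i j ∧ f = X i * X j}

/-- `G` is Cohen-Macaulay over the field `K` if `K[x_1, …, x_n] / I(G)` is a Cohen-Macaulay
ring. -/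
def IsCohenMacaulayOver (K : Type u) [Field K] (G : SimpleGraph (Fin n)) : Prop :=
  IsCohenMacaulayRing (MvPolynomial (Fin n) K ⧸ edgeIdeal K G)

/-- `G` is Cohen-Macaulay if it is Cohen-Macaulay over every field. -/
def IsCohenMacaulay (G : SimpleGraph (Fin n)) : Prop :=
  ∀ (K : Type v) [Field K], IsCohenMacaulayOver K G

end CohenMacaulayChordal

open CohenMacaulayChordal

/-!
The algebra works for any partition of the vertices into cliques `F_1, …, F_m` each of which contains
a vertex `v_i` without neighbours outside it. In the edge ring `R` put `y_i = ∑ j ∈ F_i, x_j`. As the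
`x_j` of one clique annihilate each other, `x_j ^ 2 = y_i x_j` for `j ∈ F_i`. It follows that `R` is
free over `A = K[y_1, …, y_m]`, with basis the squarefree monomials `x_W` for `W` independent and
disjoint from `{v_1, …, v_m}`: they span because the span is stable under the `x_j`
(`span_basicMonomial`), and they are independent because each `W` has a retraction `R → A` that kills
`x_W'` unless `W' ⊆ W` (`exists_retraction`). Flatness carries regular sequences from `A` to `R`. For
`X_1, …, X_m` this is the regularity of the `y_i`. The Cohen-Macaulay property has to be checked at
maximal ideals `p` other than the origin as well, and there the sequence of the `f_i(y_i)` is used,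
where `f_i` is the minimal polynomial of `y_i` modulo `p`. The dimension is `m` because `R` is
integral over `A`.

A Cohen-Macaulay ring is equidimensional at each of its maximal ideals
(`height_le_coheight_of_isCohenMacaulayRing`), and the minimal primes of `R` given by minimal vertex
covers `C` have quotients of dimension `n - |C|`, so Cohen-Macaulay graphs are unmixed.

Chordality is needed to pass from unmixed graphs to the partition. A chordal graph is covered by `k`
cliques for some independent set of size `k` (`exists_cliqueCover`). If the graph is unmixed, all
maximal independent sets have size `k`, and so meet each of these cliques in exactly one vertex. In a
chordal graph a clique that meets all maximal independent sets is the closed neighbourhood of one of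
its vertices (`exists_simplicial_of_forall_isMaximalIndepSet`), that is, a facet with a free vertex.
Both facts rest on the same lemma: a connected set outside a clique `Q` contains a vertex adjacent
to everything in `Q` that the set is adjacent to (`exists_dominating`).
-/

/-! ### Walks and chords -/

namespace SimpleGraph.Walk

variable {V : Type*} {G : SimpleGraph V}

/-- A chord is a shortcut. -/
theorem exists_shorter_of_isChord {a d x y : V} (p : G.Walk a d) (hx : x ∈ p.support)
    (hy : y ∈ p.support) (hxy : G.Adj x y) (he : s(x, y) ∉ p.edges) :
    ∃ r : G.Walk a d, r.length < p.length ∧ r.support ⊆ p.support := by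
  obtain ⟨i, rfl, hi⟩ := mem_support_iff_exists_getVert.1 hx
  obtain ⟨j, rfl, hj⟩ := mem_support_iff_exists_getVert.1 hy
  clear hx hy
  wlog hij : i ≤ j generalizing i j
  · exact this j hj i hi hxy.symm (by rwa [Sym2.eq_swap]) (by omega)
  have hne : i ≠ j := by rintro rfl; exact hxy.ne rfl
  have hne1 : i + 1 ≠ j := by
    rintro rfl
    exact he (p.mk_mem_edges_iff_exists.2 ⟨i, by omega, rfl⟩)
  refine ⟨(p.take i).append (cons hxy (p.drop j)), ?_, ?_⟩
  · rw [length_append, length_cons, take_length, drop_length]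
    omega
  · intro z hz
    rw [mem_support_append_iff, support_cons, List.mem_cons, support_take,
      drop_support_eq_support_drop_min] at hz
    rcases hz with hz | rfl | hz
    · exact List.mem_of_mem_take hz
    · exact p.getVert_mem_support i
    · exact List.mem_of_mem_drop hz

end SimpleGraph.Walk

namespace CohenMacaulayChordal

open RingTheory.Sequence
open scoped Pointwise

/-! ### Regular sequences and chains of primes -/

/-- Above an associated prime `P` of `M` there is a chain of primes at least as long as any given
regular sequence on `M`. If `r` is the first member of the sequence, Nakayama's lemma gives an
element of `M` killed by `P` that is not in `r • M`, and hence an associated prime of `M / r M` that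
contains `P` and `r`. -/
theorem IsRegular.length_le_coheight {R : Type*} [CommRing R] [IsLocalRing R]
    [IsNoetherianRing R] (rs : List R) {M : Type*} [AddCommGroup M] [Module R M]
    [Module.Finite R M] (h : IsRegular M rs) (P : PrimeSpectrum R)
    (hP : IsAssociatedPrime P.asIdeal M) : (rs.length : ℕ∞) ≤ Order.coheight P := by
  induction rs generalizing M P with
  | nil => simp
  | cons r rs ih =>
    obtain ⟨hr, hrs⟩ := (isRegular_cons_iff M r rs).mp h
    have hnt := hrs.nontrivial
    have hrm : r ∈ IsLocalRing.maximalIdeal R := by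
      rw [IsLocalRing.mem_maximalIdeal, mem_nonunits_iff]
      intro hu
      refine not_subsingleton (QuotSMulTop r M) ?_
      rw [QuotSMulTop, Submodule.Quotient.subsingleton_iff, eq_top_iff]
      rintro z -
      obtain ⟨u, rfl⟩ := hu
      exact (Submodule.mem_smul_pointwise_iff_exists _ _ _).2
        ⟨(↑u⁻¹ : R) • z, trivial, by rw [smul_smul, Units.mul_inv, one_smul]⟩
    obtain ⟨-, x, hx⟩ := (isAssociatedPrime_iff).1 hP
    have hann : ∀ a, a ∈ P.asIdeal ↔ a • x = 0 := fun a => by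
      rw [hx, Submodule.mem_colon_singleton, Submodule.mem_bot]
    have hx0 : x ≠ 0 := by
      rintro rfl
      exact P.2.ne_top ((Ideal.eq_top_iff_one _).2 ((hann 1).2 (smul_zero _)))
    have hrP : r ∉ P.asIdeal := fun hmem => hx0 (hr (by simpa using (hann r).1 hmem))
    let N : Submodule R M := Submodule.torsionBySet R M P.asIdeal
    have hN : ∀ z, z ∈ N ↔ ∀ a ∈ P.asIdeal, a • z = 0 := fun z => by
      simp [N, Submodule.mem_torsionBySet_iff]
    obtain ⟨z, hzN, hz⟩ : ∃ z ∈ N, z ∉ r • (⊤ : Submodule R M) := by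
      by_contra! hcon
      have hle : N ≤ Ideal.span {r} • N := by
        intro z hz
        obtain ⟨w, -, rfl⟩ := (Submodule.mem_smul_pointwise_iff_exists _ _ _).1 (hcon z hz)
        refine Submodule.smul_mem_smul (Ideal.mem_span_singleton_self r) ((hN w).2 fun a ha => ?_)
        refine hr ?_
        have := (hN _).1 hz a ha
        simpa [smul_comm a r w] using this
      have := Submodule.eq_bot_of_le_smul_of_le_jacobson_bot _ N (IsNoetherian.noetherian N) hle
        (by rw [IsLocalRing.jacobson_eq_maximalIdeal _ bot_ne_top]
            exact (Ideal.span_singleton_le_iff_mem _).2 hrm)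
      have hxN : x ∈ N := (hN x).2 fun a ha => (hann a).1 ha
      rw [this] at hxN
      exact hx0 hxN
    let zb : QuotSMulTop r M := Submodule.Quotient.mk z
    have hzb : zb ≠ 0 := fun h0 => hz ((Submodule.Quotient.mk_eq_zero _).1 h0)
    obtain ⟨Q, hQ, hle⟩ := exists_le_isAssociatedPrime_of_isNoetherianRing R zb hzb
    have hle' : ∀ a, a • zb = 0 → a ∈ Q := fun a ha =>
      hle (by rw [Submodule.mem_colon_singleton, Submodule.mem_bot]; exact ha)
    have hlt : P < ⟨Q, hQ.isPrime⟩ := by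
      rw [← PrimeSpectrum.asIdeal_lt_asIdeal]
      refine lt_of_le_of_ne (fun a ha => hle' a ?_) fun heq => hrP ?_
      · change Submodule.Quotient.mk (a • z) = _
        rw [(hN z).1 hzN a ha]
        rfl
      · rw [heq]
        refine hle' r ?_
        exact (Submodule.Quotient.mk_eq_zero _).2
          ((Submodule.mem_smul_pointwise_iff_exists _ _ _).2 ⟨z, trivial, rfl⟩)
    have h1 := ih hrs ⟨Q, hQ.isPrime⟩ hQ
    have h2 := Order.coheight_add_one_le hlt
    rw [List.length_cons, Nat.cast_add, Nat.cast_one]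
    exact (add_le_add_left h1 1).trans h2

theorem depth_le_coheight {R : Type*} [CommRing R] [IsLocalRing R] [IsNoetherianRing R]
    (P : PrimeSpectrum R) (hP : P.asIdeal ∈ minimalPrimes R) :
    depth R ≤ Order.coheight P := by
  refine iSup_le fun rs => IsRegular.length_le_coheight rs.1 rs.2 P ?_
  have := Module.associatedPrimes.minimalPrimes_annihilator_subset_associatedPrimes R R
  exact this (by simpa [Module.annihilator_eq_bot.2 inferInstance] using hP)

theorem depth_le_ringKrullDim (R : Type*) [CommRing R] [IsLocalRing R] [IsNoetherianRing R] :
    (depth R : WithBot ℕ∞) ≤ ringKrullDim R := by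
  obtain ⟨P, hP⟩ := (Ideal.nonempty_minimalPrimes (I := (⊥ : Ideal R)) bot_ne_top)
  exact (WithBot.coe_le_coe.2 (depth_le_coheight ⟨P, hP.1.1⟩ hP)).trans
    (Order.coheight_le_krullDim _)

/-- Cohen-Macaulay rings are locally equidimensional: the primes above a minimal prime `P ≤ 𝔪` form
chains at least as long as the height of `𝔪`. -/
theorem height_le_coheight_of_isCohenMacaulayRing {R : Type*} [CommRing R]
    (hR : IsCohenMacaulayRing R) (𝔪 : Ideal R) [h𝔪 : 𝔪.IsMaximal] (P : PrimeSpectrum R)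
    (hP : P.asIdeal ∈ minimalPrimes R) (hle : P.asIdeal ≤ 𝔪) :
    𝔪.height ≤ Order.coheight P := by
  obtain ⟨hN, hdepth⟩ := hR.2 𝔪
  let L := Localization.AtPrime 𝔪
  have hdisj : Disjoint (𝔪.primeCompl : Set R) (P.asIdeal : Set R) := by
    rw [Set.disjoint_left]
    exact fun a ha hb => ha (hle hb)
  have hp := IsLocalization.isPrime_of_isPrime_disjoint 𝔪.primeCompl L P.asIdeal P.2 hdisj
  have hcomap := IsLocalization.under_map_of_isPrime_disjoint 𝔪.primeCompl L P.2 hdisj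
  have hmono : StrictMono (PrimeSpectrum.comap (algebraMap R L)) :=
    (show Monotone (PrimeSpectrum.comap (algebraMap R L)) from
      fun a b hab => Ideal.comap_mono hab).strictMono_of_injective
      (PrimeSpectrum.localization_comap_injective L 𝔪.primeCompl)
  let P' : PrimeSpectrum L := ⟨_, hp⟩
  have hP'P : PrimeSpectrum.comap (algebraMap R L) P' = P := PrimeSpectrum.ext hcomap
  have hmin : P'.asIdeal ∈ minimalPrimes L := by
    refine ⟨⟨hp, bot_le⟩, fun Q hQ hQP => ?_⟩
    have h1 : Q.comap (algebraMap R L) ≤ P.asIdeal := (Ideal.comap_mono hQP).trans hcomap.le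
    have hQ1 := hQ.1
    have h2 := hP.2 ⟨Ideal.comap_isPrime (algebraMap R L) Q, bot_le⟩ h1
    exact Ideal.map_le_iff_le_comap.2 h2
  rw [← WithBot.coe_le_coe, ← IsLocalization.AtPrime.ringKrullDim_eq_height 𝔪 L, ← hdepth,
    WithBot.coe_le_coe]
  refine (depth_le_coheight P' hmin).trans ?_
  rw [← hP'P]
  exact Order.coheight_le_coheight_apply_of_strictMono _ hmono _

/-- The quotient of `C[X]` by a monic polynomial is free, hence flat, over `C`. -/
theorem isWeaklyRegular_polynomial_cons {C : Type*} [CommRing C] (f : Polynomial C)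
    (hf : f.Monic) (rs : List C) (hrs : IsWeaklyRegular C rs) :
    IsWeaklyRegular (Polynomial C) (f :: rs.map (algebraMap C (Polynomial C))) := by
  refine IsWeaklyRegular.cons ?_ ?_
  · rw [isSMulRegular_iff_right_eq_zero_of_smul]
    intro g hg
    exact (hf.mul_right_eq_zero_iff).1 hg
  · have := hf.free_quotient
    have h1 : IsWeaklyRegular (Polynomial C ⧸ Ideal.span {f}) rs :=
      (isWeaklyRegular_map_algebraMap_iff _ _ rs).1 (hrs.of_flat (S := Polynomial C ⧸ Ideal.span {f}))
    have h2 := (isWeaklyRegular_map_algebraMap_iff (Polynomial C) _ rs).2 h1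
    refine (LinearEquiv.isWeaklyRegular_congr
      (Submodule.quotEquivOfEq _ _ ?_) _).1 h2
    rw [← Submodule.ideal_span_singleton_smul]
    simp

theorem isWeaklyRegular_aeval_X {K : Type*} [CommRing K] {m : ℕ} (f : Fin m → Polynomial K)
    (hf : ∀ i, (f i).Monic) :
    IsWeaklyRegular (MvPolynomial (Fin m) K)
      (List.ofFn fun i => Polynomial.aeval (X i : MvPolynomial (Fin m) K) (f i)) := by
  induction m with
  | zero => simp
  | succ m ih =>
    have h1 := isWeaklyRegular_polynomial_cons
      ((f 0).map (algebraMap K (MvPolynomial (Fin m) K))) ((hf 0).map _) _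
      (ih (fun i => f i.succ) fun i => hf _)
    let e := finSuccEquiv K m
    refine (e.symm.toAddEquiv.isWeaklyRegular_congr ?_).1 h1
    have key : (List.ofFn fun i => Polynomial.aeval (X i : MvPolynomial (Fin (m + 1)) K) (f i)) =
        List.map e.symm ((f 0).map (algebraMap K (MvPolynomial (Fin m) K)) ::
          List.map (algebraMap (MvPolynomial (Fin m) K) (Polynomial (MvPolynomial (Fin m) K)))
          (List.ofFn fun i => Polynomial.aeval (X i : MvPolynomial (Fin m) K) (f i.succ))) := by
      rw [List.ofFn_succ, List.map_cons, List.map_map, List.map_ofFn]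
      congr 1
      · rw [eq_comm, AlgEquiv.symm_apply_eq]
        have h0 : e (X 0) = Polynomial.X := finSuccEquiv_X_zero
        have h2 := Polynomial.aeval_algHom_apply e (X 0) (f 0)
        rw [← h2, h0]
        exact (Polynomial.aeval_X_left_eq_map _).symm
      · congr 1
        ext1 i
        have h0 : e (X i.succ) = Polynomial.C (X i) := finSuccEquiv_X_succ
        have h2 := Polynomial.aeval_algHom_apply e (X i.succ) (f i.succ)
        rw [Function.comp_apply, Function.comp_apply, eq_comm, AlgEquiv.symm_apply_eq, ← h2, h0]
        exact (Polynomial.aeval_algebraMap_apply _ _ _).symm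
    rw [key]
    refine List.forall₂_map_right_iff.2 (List.forall₂_same.2 fun r _ x => ?_)
    simp

/-! ### Edge rings of graphs with a partition into simplicial cliques -/

/-- The edge ring `K[x_1, …, x_n] / I(G)`. It is a type synonym, not an abbreviation, so that
instance search does not unfold the quotient when the ring is viewed as an algebra over a ring of
parameters. -/
def EdgeRing {n : ℕ} (K : Type*) [Field K] (G : SimpleGraph (Fin n)) : Type _ :=
  MvPolynomial (Fin n) K ⧸ edgeIdeal K G

namespace EdgeRing

variable {n : ℕ} (K : Type*) [Field K] (G : SimpleGraph (Fin n))

noncomputable instance : CommRing (EdgeRing K G) :=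
  inferInstanceAs (CommRing (MvPolynomial (Fin n) K ⧸ edgeIdeal K G))

noncomputable instance : Algebra K (EdgeRing K G) :=
  inferInstanceAs (Algebra K (MvPolynomial (Fin n) K ⧸ edgeIdeal K G))

noncomputable instance : Algebra (MvPolynomial (Fin n) K) (EdgeRing K G) :=
  inferInstanceAs (Algebra (MvPolynomial (Fin n) K) (MvPolynomial (Fin n) K ⧸ edgeIdeal K G))

instance : IsNoetherianRing (EdgeRing K G) :=
  inferInstanceAs (IsNoetherianRing (MvPolynomial (Fin n) K ⧸ edgeIdeal K G))

/-- The quotient map onto the edge ring, as a homomorphism of `K`-algebras. -/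
noncomputable def mk : MvPolynomial (Fin n) K →ₐ[K] EdgeRing K G :=
  Ideal.Quotient.mkₐ K (edgeIdeal K G)

theorem mk_surjective : Function.Surjective (mk K G) := Ideal.Quotient.mk_surjective

instance : Algebra.FiniteType K (EdgeRing K G) :=
  Algebra.FiniteType.of_surjective (mk K G) (mk_surjective K G)

theorem algebraMap_eq_mk (f : MvPolynomial (Fin n) K) :
    algebraMap (MvPolynomial (Fin n) K) (EdgeRing K G) f = mk K G f := rfl

variable {K G}

theorem mk_X_mul_mk_X {i j : Fin n} (h : G.Adj i j) : mk K G (X i) * mk K G (X j) = 0 := by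
  rw [← map_mul]
  exact Ideal.Quotient.eq_zero_iff_mem.2 (Ideal.subset_span ⟨i, j, h, rfl⟩)

/-- The universal property of the edge ring: a family indexed by the vertices in which adjacent
members have product zero defines a homomorphism. -/
noncomputable def lift {B : Type*} [CommRing B] [Algebra K B] (g : Fin n → B)
    (hg : ∀ i j, G.Adj i j → g i * g j = 0) : EdgeRing K G →ₐ[K] B :=
  Ideal.Quotient.liftₐ (edgeIdeal K G) (aeval g) fun a ha => by
    have : edgeIdeal K G ≤ RingHom.ker (aeval g : MvPolynomial (Fin n) K →ₐ[K] B) := by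
      refine Ideal.span_le.2 ?_
      rintro _ ⟨i, j, hij, rfl⟩
      simp [RingHom.mem_ker, hg i j hij]
    exact this ha

@[simp]
theorem lift_mk {B : Type*} [CommRing B] [Algebra K B] (g : Fin n → B)
    (hg : ∀ i j, G.Adj i j → g i * g j = 0) (f : MvPolynomial (Fin n) K) :
    lift g hg (mk K G f) = aeval g f := rfl

variable (K G)

instance : Nontrivial (EdgeRing K G) :=
  (lift (K := K) (B := K) (G := G) (fun _ => 0) (by simp)).toRingHom.domain_nontrivial

end EdgeRing

/-- The vertices of `G` are partitioned by `c` into cliques `c ⁻¹ {i}`, and each clique contains a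
vertex `v i` whose neighbours all lie in that clique. -/
structure IsSimplicialCliquePartition {n m : ℕ} (G : SimpleGraph (Fin n)) (c : Fin n → Fin m)
    (v : Fin m → Fin n) : Prop where
  color_apply : ∀ i, c (v i) = i
  adj_of_color_eq : ∀ {x y}, c x = c y → x ≠ y → G.Adj x y
  color_eq_of_adj : ∀ {i x}, G.Adj (v i) x → c x = i

namespace IsSimplicialCliquePartition

variable {n m : ℕ} {G : SimpleGraph (Fin n)} {c : Fin n → Fin m} {v : Fin m → Fin n}

/-- The sum of the variables of the `i`-th class of the partition `c`. -/
noncomputable def linearForm (K : Type*) [Field K] (c : Fin n → Fin m) (i : Fin m) :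
    MvPolynomial (Fin n) K :=
  ∑ j with c j = i, X j

/-- The homomorphism from `K[X_1, …, X_m]` to the edge ring that sends `X_i` to the `i`-th linear
form. -/
noncomputable def parameterHom (K : Type*) [Field K] (G : SimpleGraph (Fin n))
    (c : Fin n → Fin m) :
    MvPolynomial (Fin m) K →ₐ[K] EdgeRing K G :=
  aeval fun i => EdgeRing.mk K G (linearForm K c i)

/-- The independent sets that avoid all the vertices `v i`; they index a basis of the edge ring
over `K[X_1, …, X_m]`. -/
def IsBasicSet (G : SimpleGraph (Fin n)) (v : Fin m → Fin n) (W : Finset (Fin n)) : Prop :=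
  G.IsIndepSet (W : Set (Fin n)) ∧ ∀ i, v i ∉ W

/-- The product of the variables in `W`, in the edge ring. -/
noncomputable def basicMonomial (K : Type*) [Field K] (G : SimpleGraph (Fin n))
    (W : Finset (Fin n)) : EdgeRing K G :=
  ∏ j ∈ W, EdgeRing.mk K G (X j)

open Classical in
/-- The value at `x_j` of a retraction of `parameterHom`, for an independent set `W` that avoids the
`v i`. Complete `W` by the vertices `v i` of the cliques that `W` misses: the members `j` of this
transversal are sent to `X_(c j)`, all other vertices to `0`. -/
noncomputable def retractionValue (K : Type*) [Field K] (c : Fin n → Fin m) (v : Fin m → Fin n)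
    (W : Finset (Fin n)) (j : Fin n) : MvPolynomial (Fin m) K :=
  if j ∈ W ∨ (j = v (c j) ∧ ∀ w ∈ W, c w ≠ c j) then X (c j) else 0

/-- The retraction defined by `retractionValue` is well defined because the transversal that completes
`W` is independent. -/
theorem exists_retraction (K : Type*) [Field K] (h : IsSimplicialCliquePartition G c v)
    {W : Finset (Fin n)} (hW : IsBasicSet G v W) :
    ∃ ψ : EdgeRing K G →ₐ[K] MvPolynomial (Fin m) K,
      (∀ a, ψ (parameterHom K G c a) = a) ∧ ψ (basicMonomial K G W) ≠ 0 ∧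
      ∀ W', (∀ i, v i ∉ W') → ¬ W' ⊆ W → ψ (basicMonomial K G W') = 0 := by
  classical
  have hindep : ∀ {x y}, x ∈ W → y ∈ W → ¬ G.Adj x y := fun {x y} hx hy hxy =>
    hW.1 hx hy hxy.ne hxy
  have hg : ∀ i j, G.Adj i j → retractionValue K c v W i * retractionValue K c v W j = 0 := by
    intro i j hij
    unfold retractionValue
    split_ifs with h1 h2
    · exfalso
      rcases h1 with h1 | ⟨h1, h1'⟩ <;> rcases h2 with h2 | ⟨h2, h2'⟩
      · exact hindep h1 h2 hij
      · rw [h2] at hij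
        exact h2' i h1 (h.color_eq_of_adj hij.symm)
      · rw [h1] at hij
        exact h1' j h2 (h.color_eq_of_adj hij)
      · have h3 := hij
        rw [h1] at h3
        have h4 := h.color_eq_of_adj h3
        rw [h1, h2, h4] at hij
        exact hij.ne rfl
    all_goals simp
  have hsum : ∀ i, ∑ j with c j = i, retractionValue K c v W j = X i := by
    intro i
    by_cases hi : ∃ w ∈ W, c w = i
    · obtain ⟨w, hw, hwi⟩ := hi
      rw [Finset.sum_eq_single_of_mem w (by simpa using hwi)]
      · simp [retractionValue, hw, hwi]
      · intro j hj hjw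
        have hj' : c j = i := by simpa using hj
        refine if_neg ?_
        rintro (h1 | ⟨-, h1⟩)
        · exact hindep h1 hw (h.adj_of_color_eq (hj'.trans hwi.symm) hjw)
        · exact h1 w hw (hwi.trans hj'.symm)
    · push Not at hi
      rw [Finset.sum_eq_single_of_mem (v i) (by simpa using h.color_apply i)]
      · unfold retractionValue
        rw [h.color_apply, if_pos (Or.inr ⟨rfl, hi⟩)]
      · intro j hj hjv
        have hj' : c j = i := by simpa using hj
        refine if_neg ?_
        rintro (h1 | ⟨h1, -⟩)
        · exact hi j h1 hj'
        · exact hjv (by rw [h1, hj'])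
  refine ⟨EdgeRing.lift _ hg, fun a => ?_, ?_, fun W' hW' hWW' => ?_⟩
  · have : ((EdgeRing.lift _ hg).comp (parameterHom K G c)) = AlgHom.id K _ := by
      refine MvPolynomial.algHom_ext fun i => ?_
      simp only [AlgHom.comp_apply, parameterHom, aeval_X, EdgeRing.lift_mk, linearForm, map_sum,
        AlgHom.id_apply]
      exact hsum i
    exact DFunLike.congr_fun this a
  · unfold basicMonomial
    rw [map_prod, Finset.prod_ne_zero_iff]
    intro j hj
    rw [EdgeRing.lift_mk, aeval_X, retractionValue, if_pos (Or.inl hj)]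
    exact X_ne_zero _
  · obtain ⟨j, hj, hjW⟩ := Finset.not_subset.1 hWW'
    unfold basicMonomial
    rw [map_prod]
    refine Finset.prod_eq_zero hj ?_
    rw [EdgeRing.lift_mk, aeval_X]
    refine if_neg ?_
    rintro (h1 | ⟨h1, -⟩)
    · exact hjW h1
    · exact hW' _ (h1 ▸ hj)

theorem parameterHom_X (K : Type*) [Field K] (i : Fin m) :
    parameterHom K G c (X i) = EdgeRing.mk K G (linearForm K c i) := by
  simp [parameterHom]

theorem mk_X_mul_linearForm (K : Type*) [Field K] (h : IsSimplicialCliquePartition G c v)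
    (j : Fin n) :
    EdgeRing.mk K G (linearForm K c (c j)) * EdgeRing.mk K G (X j) =
      EdgeRing.mk K G (X j) * EdgeRing.mk K G (X j) := by
  unfold linearForm
  rw [map_sum, Finset.sum_mul, Finset.sum_eq_single_of_mem j (by simp)]
  intro i hi hij
  exact EdgeRing.mk_X_mul_mk_X (h.adj_of_color_eq (by simpa using hi) hij)

/-- The span is stable under multiplication by every variable: `x_j ^ 2 = y_(c j) x_j` reduces the
exponents, and the variable of `v i` is `y_i` minus the other variables of its clique. -/
theorem span_basicMonomial (K : Type*) [Field K] (h : IsSimplicialCliquePartition G c v) :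
    let _ := (parameterHom K G c).toRingHom.toAlgebra
    Submodule.span (MvPolynomial (Fin m) K)
      (Set.range fun W : {W : Finset (Fin n) // IsBasicSet G v W} => basicMonomial K G W.1) =
        ⊤ := by
  classical
  intro _
  have hsmul : ∀ (a : MvPolynomial (Fin m) K) (r : EdgeRing K G),
      a • r = parameterHom K G c a * r := fun a r => rfl
  set M := Submodule.span (MvPolynomial (Fin m) K)
      (Set.range fun W : {W : Finset (Fin n) // IsBasicSet G v W} => basicMonomial K G W.1)
  have hmem : ∀ W, IsBasicSet G v W → basicMonomial K G W ∈ M := fun W hW =>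
    Submodule.subset_span ⟨⟨W, hW⟩, rfl⟩
  have hnonfree : ∀ W, IsBasicSet G v W → ∀ j, j ≠ v (c j) →
      EdgeRing.mk K G (X j) * basicMonomial K G W ∈ M := by
    intro W hW j hj
    by_cases hjW : j ∈ W
    · have := M.smul_mem (X (c j)) (hmem W hW)
      rw [hsmul, parameterHom_X] at this
      convert this using 1
      unfold basicMonomial
      rw [← Finset.mul_prod_erase W _ hjW, ← mul_assoc, ← mul_assoc, h.mk_X_mul_linearForm K]
    · by_cases hind : ∃ w ∈ W, G.Adj j w
      · obtain ⟨w, hw, hjw⟩ := hind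
        unfold basicMonomial
        rw [← Finset.mul_prod_erase W _ hw, ← mul_assoc, EdgeRing.mk_X_mul_mk_X hjw, zero_mul]
        exact M.zero_mem
      · push Not at hind
        have := hmem (insert j W) ⟨?_, ?_⟩
        · unfold basicMonomial at this ⊢
          rwa [Finset.prod_insert hjW] at this
        · rw [Finset.coe_insert, SimpleGraph.IsIndepSet, Set.pairwise_insert]
          exact ⟨hW.1, fun w hw _ => ⟨hind w hw, fun hwj => hind w hw hwj.symm⟩⟩
        · intro i hi
          rcases Finset.mem_insert.1 hi with hi | hi
          · exact hj (by rw [← hi, h.color_apply])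
          · exact hW.2 i hi
  have hvar : ∀ W, IsBasicSet G v W → ∀ j,
      EdgeRing.mk K G (X j) * basicMonomial K G W ∈ M := by
    intro W hW j
    by_cases hj : j = v (c j)
    · -- the free variable is the linear form minus the other variables of its clique
      have h1 : EdgeRing.mk K G (X j) * basicMonomial K G W =
          (X (c j) : MvPolynomial (Fin m) K) • basicMonomial K G W -
          ∑ i ∈ (Finset.univ.filter fun i => c i = c j).erase j,
            EdgeRing.mk K G (X i) * basicMonomial K G W := by
        rw [hsmul, parameterHom_X, eq_sub_iff_add_eq, ← Finset.sum_mul, ← add_mul]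
        unfold linearForm
        rw [map_sum, Finset.add_sum_erase _ (fun i => EdgeRing.mk K G (X i)) (by simp)]
      rw [h1]
      refine M.sub_mem (M.smul_mem _ (hmem W hW)) (M.sum_mem fun i hi => hnonfree W hW i ?_)
      simp only [Finset.mem_erase, Finset.mem_filter, Finset.mem_univ, true_and] at hi
      rw [hi.2, ← hj]
      exact hi.1
    · exact hnonfree W hW j hj
  have hvarM : ∀ j, ∀ r ∈ M, EdgeRing.mk K G (X j) * r ∈ M := by
    intro j r hr
    induction hr using Submodule.span_induction with
    | mem r hr => obtain ⟨W, rfl⟩ := hr; exact hvar W.1 W.2 j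
    | zero => rw [mul_zero]; exact M.zero_mem
    | add r s _ _ hr hs => rw [mul_add]; exact M.add_mem hr hs
    | smul a r _ hr => rw [hsmul, mul_left_comm, ← hsmul]; exact M.smul_mem a hr
  rw [eq_top_iff]
  rintro r -
  obtain ⟨f, rfl⟩ := EdgeRing.mk_surjective K G r
  induction f using MvPolynomial.induction_on with
  | C a =>
    have := M.smul_mem (C a) (hmem ∅ ⟨by simp, by simp⟩)
    rw [hsmul] at this
    convert this using 1
    simp [basicMonomial, parameterHom]
  | add p q hp hq => rw [map_add]; exact M.add_mem hp hq
  | mul_X p j hp => rw [map_mul, mul_comm]; exact hvarM j _ hp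

/-- In a relation, a coefficient of a minimal set `W` is killed: the retraction attached to `W` sends
the monomials of all other sets that still occur to zero. -/
theorem linearIndependent_basicMonomial (K : Type*) [Field K]
    (h : IsSimplicialCliquePartition G c v) :
    let _ := (parameterHom K G c).toRingHom.toAlgebra
    LinearIndependent (MvPolynomial (Fin m) K)
      (fun W : {W : Finset (Fin n) // IsBasicSet G v W} => basicMonomial K G W.1) := by
  classical
  intro _
  have hsmul : ∀ (a : MvPolynomial (Fin m) K) (r : EdgeRing K G),
      a • r = parameterHom K G c a * r := fun a r => rfl
  rw [Fintype.linearIndependent_iff]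
  intro l hl
  suffices ∀ (k : ℕ) (W : {W : Finset (Fin n) // IsBasicSet G v W}), W.1.card = k → l W = 0 from
    fun W => this _ W rfl
  intro k
  induction k using Nat.strong_induction_on with
  | _ k ih =>
  intro W hWk
  obtain ⟨ψ, hψ, hψW, hψ'⟩ := h.exists_retraction K W.2
  have h1 := congrArg ψ hl
  rw [map_sum, map_zero, Finset.sum_eq_single_of_mem W (Finset.mem_univ _)] at h1
  · rw [hsmul, map_mul, hψ] at h1
    exact (mul_eq_zero.1 h1).resolve_right hψW
  · intro W' _ hWW'
    rw [hsmul, map_mul, hψ]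
    by_cases hsub : W'.1 ⊆ W.1
    · have hlt : W'.1.card < k := hWk ▸ Finset.card_lt_card
        (Finset.ssubset_iff_subset_ne.2 ⟨hsub, fun he => hWW' (Subtype.ext he)⟩)
      rw [ih _ hlt W' rfl, zero_mul]
    · rw [hψ' _ W'.2.2 hsub, mul_zero]

theorem free_finite (K : Type*) [Field K] (h : IsSimplicialCliquePartition G c v) :
    let _ := (parameterHom K G c).toRingHom.toAlgebra
    Module.Free (MvPolynomial (Fin m) K) (EdgeRing K G) ∧
    Module.Finite (MvPolynomial (Fin m) K) (EdgeRing K G) := by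
  classical
  intro _
  let b := Module.Basis.mk (h.linearIndependent_basicMonomial K) (h.span_basicMonomial K).ge
  exact ⟨Module.Free.of_basis b, Module.Finite.of_basis b⟩

theorem isWeaklyRegular_aeval (K : Type*) [Field K] (h : IsSimplicialCliquePartition G c v)
    (f : Fin m → Polynomial K) (hf : ∀ i, (f i).Monic) :
    IsWeaklyRegular (EdgeRing K G)
      (List.ofFn fun i =>
        Polynomial.aeval (EdgeRing.mk K G (linearForm K c i)) (f i)) := by
  let _ := (parameterHom K G c).toRingHom.toAlgebra
  have := (h.free_finite K).1
  have h1 := (isWeaklyRegular_aeval_X f hf).of_flat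
    (S := EdgeRing K G)
  rw [List.map_ofFn] at h1
  convert h1 using 3 with i
  rw [Function.comp_apply, ← parameterHom_X]
  exact Polynomial.aeval_algHom_apply (parameterHom K G c) _ _

theorem ringKrullDim_le (K : Type*) [Field K] (h : IsSimplicialCliquePartition G c v) :
    ringKrullDim (EdgeRing K G) ≤ m := by
  let _ := (parameterHom K G c).toRingHom.toAlgebra
  have := (h.free_finite K).2
  have hmono : StrictMono (PrimeSpectrum.comap (algebraMap (MvPolynomial (Fin m) K)
      (EdgeRing K G))) := by
    intro p q hpq
    exact Ideal.IsIntegral.comap_lt_comap hpq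
  refine (Order.krullDim_le_of_strictMono _ hmono).trans (le_of_eq ?_)
  refine (MvPolynomial.ringKrullDim_of_isNoetherianRing).trans ?_
  simp

/-- For any maximal ideal `p` the elements `y_i` are algebraic over `K` modulo `p`, and their minimal
polynomials evaluated at `y_i` give a regular sequence in `p`. -/
theorem le_depth (K : Type*) [Field K] (h : IsSimplicialCliquePartition G c v)
    (p : Ideal (EdgeRing K G)) [p.IsMaximal] :
    (m : ℕ∞) ≤ depth (Localization.AtPrime p) := by
  let _ := Ideal.Quotient.field p
  have : Module.Finite K (EdgeRing K G ⧸ p) :=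
    finite_of_finite_type_of_isJacobsonRing _ _
  let y : Fin m → EdgeRing K G ⧸ p := fun i =>
    Ideal.Quotient.mk p (EdgeRing.mk K G (linearForm K c i))
  have hy : ∀ i, IsIntegral K (y i) := fun i => Algebra.IsIntegral.isIntegral _
  have h1 := h.isWeaklyRegular_aeval K (fun i => minpoly K (y i)) fun i => minpoly.monic (hy i)
  have h2 := h1.isRegular_of_isLocalization_of_mem (Localization.AtPrime p) p ?_
  · refine le_trans ?_ (le_iSup _ ⟨_, h2⟩)
    simp
  · intro r hr
    obtain ⟨i, rfl⟩ := (List.mem_ofFn' _ _).1 hr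
    rw [← Ideal.Quotient.eq_zero_iff_mem]
    have h3 := Polynomial.aeval_algHom_apply (Ideal.Quotient.mkₐ K p)
      (EdgeRing.mk K G (linearForm K c i)) (minpoly K (y i))
    exact h3.symm.trans (minpoly.aeval K (y i))

theorem isCohenMacaulayRing (K : Type*) [Field K] (h : IsSimplicialCliquePartition G c v) :
    IsCohenMacaulayRing (EdgeRing K G) := by
  refine ⟨inferInstance, fun p hp => ⟨inferInstance, ?_⟩⟩
  refine le_antisymm (depth_le_ringKrullDim _) ?_
  refine le_trans ?_ (WithBot.coe_le_coe.2 (h.le_depth K p))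
  rw [IsLocalization.AtPrime.ringKrullDim_eq_height p]
  exact (Ideal.height_le_ringKrullDim_of_ne_top hp.ne_top).trans (h.ringKrullDim_le K)

theorem ringKrullDim_eq (K : Type*) [Field K] (h : IsSimplicialCliquePartition G c v) :
    ringKrullDim (EdgeRing K G) = m := by
  refine le_antisymm (h.ringKrullDim_le K) ?_
  obtain ⟨p, hp⟩ := Ideal.exists_maximal (EdgeRing K G)
  refine (WithBot.coe_le_coe.2 (h.le_depth K p)).trans ((depth_le_ringKrullDim _).trans ?_)
  rw [IsLocalization.AtPrime.ringKrullDim_eq_height p]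
  exact Ideal.height_le_ringKrullDim_of_ne_top hp.ne_top

theorem isRegular_linearForm (K : Type*) [Field K] (h : IsSimplicialCliquePartition G c v) :
    IsRegular (EdgeRing K G) (List.ofFn (linearForm K c)) := by
  refine ⟨?_, ?_⟩
  · have h1 := h.isWeaklyRegular_aeval K (fun _ => Polynomial.X) fun _ => Polynomial.monic_X
    rw [← isWeaklyRegular_map_algebraMap_iff (EdgeRing K G),
      List.map_ofFn]
    convert h1 using 3 with i
    simp [EdgeRing.algebraMap_eq_mk]
  · -- evaluation at the origin kills the linear forms
    intro htop
    let ε := EdgeRing.lift (K := K) (B := K) (G := G) (fun _ => 0) (by simp)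
    have hle : Ideal.ofList (List.ofFn (linearForm K c)) •
        (⊤ : Submodule (MvPolynomial (Fin n) K) (EdgeRing K G)) ≤
        (RingHom.ker ε).restrictScalars (MvPolynomial (Fin n) K) := by
      refine Submodule.smul_le.2 fun r hr x _ => ?_
      have hr' : aeval (fun _ => (0 : K)) r = 0 := by
        have : Ideal.ofList (List.ofFn (linearForm K c)) ≤
            RingHom.ker (aeval (fun _ => (0 : K)) : MvPolynomial (Fin n) K →ₐ[K] K) := by
          refine Ideal.span_le.2 fun s hs => ?_
          obtain ⟨i, rfl⟩ := (List.mem_ofFn' _ _).1 hs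
          simp [RingHom.mem_ker, linearForm]
        exact this hr
      rw [Algebra.smul_def]
      change ε (EdgeRing.mk K G r * x) = 0
      rw [map_mul]
      change aeval (fun _ => (0 : K)) r * _ = 0
      rw [hr', zero_mul]
    have h1 := hle (htop ▸ Submodule.mem_top : (1 : EdgeRing K G) ∈ _)
    have h2 : ε 1 = 0 := h1
    simp at h2

end IsSimplicialCliquePartition

/-! ### Cohen-Macaulay graphs are unmixed -/

namespace EdgeRing

variable {n : ℕ} (K : Type*) [Field K] {G : SimpleGraph (Fin n)}

theorem exists_mem_or_mem_of_adj {C : Finset (Fin n)} (hC : G.IsVertexCover (C : Set (Fin n)))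
    {i j : Fin n} (h : G.Adj i j) : i ∈ C ∨ j ∈ C := by
  simpa using hC h

/-- The quotient of the edge ring by the variables of a vertex cover is a polynomial ring. -/
noncomputable def killCover {C : Finset (Fin n)} (hC : G.IsVertexCover (C : Set (Fin n))) :
    EdgeRing K G →ₐ[K] MvPolynomial {i // i ∉ C} K :=
  lift (fun i => if h : i ∉ C then X ⟨i, h⟩ else 0) fun i j hij => by
    rcases exists_mem_or_mem_of_adj hC hij with h | h <;> simp [h]

variable {C : Finset (Fin n)} (hC : G.IsVertexCover (C : Set (Fin n)))

theorem killCover_X_of_mem {i : Fin n} (hi : i ∈ C) : killCover K hC (mk K G (X i)) = 0 := by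
  simp [killCover, hi]

theorem killCover_X_of_notMem {i : Fin n} (hi : i ∉ C) :
    killCover K hC (mk K G (X i)) = X ⟨i, hi⟩ := by
  simp [killCover, hi]

theorem killCover_surjective : Function.Surjective (killCover K hC) := by
  intro f
  refine ⟨mk K G (rename Subtype.val f), ?_⟩
  have : ((killCover K hC).comp (mk K G)).comp (rename Subtype.val) = AlgHom.id K _ := by
    refine MvPolynomial.algHom_ext fun i => ?_
    simpa using killCover_X_of_notMem K hC i.2
  exact DFunLike.congr_fun this f

/-- The prime ideal generated by the variables of a vertex cover, as the kernel of `killCover`. -/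
noncomputable def coverPrime : PrimeSpectrum (EdgeRing K G) :=
  ⟨RingHom.ker (killCover K hC), RingHom.ker_isPrime _⟩

theorem mk_X_mem_coverPrime {i : Fin n} : mk K G (X i) ∈ (coverPrime K hC).asIdeal ↔ i ∈ C := by
  change killCover K hC _ = 0 ↔ _
  by_cases hi : i ∈ C
  · simp [killCover_X_of_mem K hC hi, hi]
  · simp [killCover_X_of_notMem K hC hi, hi]

theorem coverPrime_le {I : Ideal (EdgeRing K G)} (hI : ∀ i ∈ C, mk K G (X i) ∈ I) :
    (coverPrime K hC).asIdeal ≤ I := by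
  intro x hx
  -- modulo `I`, the quotient map factors through `killCover`
  have : ((((Ideal.Quotient.mkₐ K I).comp (mk K G)).comp (rename Subtype.val)).comp
      ((killCover K hC).comp (mk K G))) = (Ideal.Quotient.mkₐ K I).comp (mk K G) := by
    refine MvPolynomial.algHom_ext fun i => ?_
    by_cases hi : i ∈ C
    · have h0 : Ideal.Quotient.mk I (mk K G (X i)) = 0 := Ideal.Quotient.eq_zero_iff_mem.2 (hI i hi)
      simp [killCover_X_of_mem K hC hi, h0]
    · simp [killCover_X_of_notMem K hC hi]
  obtain ⟨f, rfl⟩ := mk_surjective K G x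
  have h1 := DFunLike.congr_fun this f
  have h2 : killCover K hC (mk K G f) = 0 := hx
  simp only [AlgHom.comp_apply, h2, map_zero] at h1
  exact Ideal.Quotient.eq_zero_iff_mem.1 h1.symm

theorem coverPrime_mem_minimalPrimes (hmin : IsMinimalVertexCover G C) :
    (coverPrime K hmin.1).asIdeal ∈ minimalPrimes (EdgeRing K G) := by
  classical
  refine ⟨⟨(coverPrime K hmin.1).2, bot_le⟩, fun Q hQ hQC => coverPrime_le K hmin.1 fun i hi => ?_⟩
  have hQp := hQ.1
  have hcov : G.IsVertexCover
      ((Finset.univ.filter fun i => mk K G (X i) ∈ Q : Finset (Fin n)) : Set (Fin n)) := by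
    intro a b hab
    have : mk K G (X a) * mk K G (X b) ∈ Q := by
      rw [mk_X_mul_mk_X hab]
      exact Q.zero_mem
    simpa using hQp.mem_or_mem this
  have hle := hmin.2 hcov (fun j hj => (mk_X_mem_coverPrime K hmin.1).1 (hQC (by simpa using hj)))
  simpa using hle hi

theorem coheight_coverPrime_le : Order.coheight (coverPrime K hC) ≤ (n - C.card : ℕ) := by
  have h1 : Function.Surjective (killCover K hC).toRingHom := killCover_surjective K hC
  have h2 : ringKrullDim (EdgeRing K G ⧸ (coverPrime K hC).asIdeal) = (n - C.card : ℕ) := by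
    refine (ringKrullDim_eq_of_ringEquiv (RingHom.quotientKerEquivOfSurjective h1)).trans ?_
    refine (MvPolynomial.ringKrullDim_of_isNoetherianRing).trans ?_
    simp
  rw [ringKrullDim_quotient] at h2
  rw [← WithBot.coe_le_coe, Order.coheight_eq_krullDim_Ici]
  exact h2.le

/-- Adding the vertices of `D` to `C` one at a time gives a chain of primes. -/
theorem card_le_height (hC : G.IsVertexCover (C : Set (Fin n))) (k : ℕ) (D : Finset (Fin n))
    (hCD : C ⊆ D) (hk : k + C.card = D.card) (hD : G.IsVertexCover (D : Set (Fin n))) :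
    (k : ℕ∞) ≤ (coverPrime K hD).asIdeal.height := by
  classical
  induction k generalizing D with
  | zero => simp
  | succ k ih =>
    obtain ⟨a, haD, haC⟩ := Finset.exists_mem_notMem_of_card_lt_card (show C.card < D.card by omega)
    have hsub : C ⊆ D.erase a := fun i hi =>
      Finset.mem_erase.2 ⟨fun h => haC (h ▸ hi), hCD hi⟩
    have hcov : G.IsVertexCover ((D.erase a : Finset (Fin n)) : Set (Fin n)) :=
      hC.subset (by exact_mod_cast hsub)
    have h1 := ih (D.erase a) hsub (by rw [Finset.card_erase_of_mem haD]; omega) hcov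
    have hlt : (coverPrime K hcov).asIdeal < (coverPrime K hD).asIdeal := by
      refine lt_of_le_of_ne (coverPrime_le K hcov fun i hi => ?_) fun he => ?_
      · exact (mk_X_mem_coverPrime K hD).2 (Finset.mem_of_mem_erase hi)
      · have := (mk_X_mem_coverPrime K hD).2 haD
        rw [← he, mk_X_mem_coverPrime] at this
        simp at this
    have h2 := Ideal.height_add_one_le_of_lt_of_isPrime hlt
    push_cast
    exact (add_le_add_left h1 1).trans h2

end EdgeRing

/-- At a maximal ideal that contains all the variables, the minimal primes given by the minimal
covers `C` and `D` both lie below. The chain that starts at the second one has length `n - |D|`, and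
every chain that starts at the first one has length at most `n - |C|`. -/
theorem isUnmixed_of_isCohenMacaulayOver {n : ℕ} {K : Type*} [Field K] {G : SimpleGraph (Fin n)}
    (h : IsCohenMacaulayOver K G) : IsUnmixed G := by
  have hR : IsCohenMacaulayRing (EdgeRing K G) := h
  suffices ∀ C D : Finset (Fin n), IsMinimalVertexCover G C → IsMinimalVertexCover G D →
      C.card ≤ D.card from fun C D hC hD => (this C D hC hD).antisymm (this D C hD hC)
  intro C D hC hD
  have huniv : G.IsVertexCover ((Finset.univ : Finset (Fin n)) : Set (Fin n)) := by
    simp [SimpleGraph.IsVertexCover]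
  obtain ⟨𝔪, h𝔪, hle⟩ := Ideal.exists_le_maximal (EdgeRing.coverPrime K huniv).asIdeal
    (EdgeRing.coverPrime K huniv).2.ne_top
  have h1 := height_le_coheight_of_isCohenMacaulayRing hR 𝔪 (EdgeRing.coverPrime K hC.1)
    (EdgeRing.coverPrime_mem_minimalPrimes K hC)
    ((EdgeRing.coverPrime_le K hC.1 fun i _ =>
      (EdgeRing.mk_X_mem_coverPrime K huniv).2 (Finset.mem_univ i)).trans hle)
  have hDn := D.card_le_univ
  have hCn := C.card_le_univ
  rw [Fintype.card_fin] at hDn hCn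
  have h2 := EdgeRing.card_le_height K hD.1 (n - D.card) Finset.univ (Finset.subset_univ _)
    (by simp; omega) huniv
  have h3 := (h2.trans (Ideal.height_mono hle)).trans
    (h1.trans (EdgeRing.coheight_coverPrime_le K hC.1))
  have h4 : n - D.card ≤ n - C.card := by exact_mod_cast h3
  omega

/-! ### Clique covers of chordal graphs -/

namespace IsChordal

variable {n : ℕ} {G : SimpleGraph (Fin n)}

/-- In a chordal graph no walk joins the two ends of an edge `q q'` from outside if it avoids their
common neighbours: a shortest such walk, closed up through `q` and `q'`, would be a chordless
cycle. -/
theorem not_walk_of_adj (hG : IsChordal G) {q q' : Fin n} (hqq : G.Adj q q') {a d : Fin n}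
    (p : G.Walk a d) (ha : G.Adj q' a) (hd : G.Adj d q)
    (hT : ∀ z ∈ p.support, z ≠ q ∧ z ≠ q' ∧ ¬(G.Adj z q ∧ G.Adj z q')) : False := by
  classical
  suffices ∀ (k : ℕ) (a d : Fin n) (p : G.Walk a d), p.length = k → G.Adj q' a → G.Adj d q →
      (∀ z ∈ p.support, z ≠ q ∧ z ≠ q' ∧ ¬(G.Adj z q ∧ G.Adj z q')) → False from
    this _ a d p rfl ha hd hT
  clear! a d
  intro k
  induction k using Nat.strong_induction_on with
  | _ k ih =>
  intro a d p hk ha hd hT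
  have hshort : ∀ {a' d' : Fin n} (r : G.Walk a' d'), G.Adj q' a' → G.Adj d' q →
      r.support ⊆ p.support → p.length ≤ r.length := by
    intro a' d' r ha' hd' hsub
    by_contra! hlt
    exact ih _ (hk ▸ hlt) a' d' r rfl ha' hd' fun z hz => hT z (hsub hz)
  have hpath : p.IsPath := by
    rw [← p.bypass_eq_self_of_length_le_length_bypass
      (hshort _ ha hd p.support_bypass_subset_support)]
    exact p.bypass_isPath
  have hlen : p.length ≠ 0 := fun h0 => by
    have had := p.eq_of_length_eq_zero h0
    subst had
    exact (hT a p.start_mem_support).2.2 ⟨hd, ha.symm⟩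
  have hq : ∀ y ∈ p.support, G.Adj y q → y = d := by
    intro y hy hyq
    by_contra hyd
    have h1 := hshort (p.takeUntil y hy) ha hyq (p.support_takeUntil_subset_support hy)
    have h2 := SimpleGraph.Walk.length_takeUntil_lt_length hy hyd
    omega
  have hq' : ∀ y ∈ p.support, G.Adj y q' → y = a := by
    intro y hy hyq
    by_contra hyd
    have h1 := hshort (p.dropUntil y hy) hyq.symm hd (p.support_dropUntil_subset_support hy)
    have h2 := SimpleGraph.Walk.length_dropUntil_lt_length hy hyd
    omega
  have hqp : q ∉ p.support := fun h => (hT q h).1 rfl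
  have hq'p : q' ∉ p.support := fun h => (hT q' h).2.1 rfl
  have hc : (SimpleGraph.Walk.cons hqq (SimpleGraph.Walk.cons ha (p.concat hd))).IsCycle := by
    rw [SimpleGraph.Walk.cons_isCycle_iff, SimpleGraph.Walk.cons_isPath_iff]
    refine ⟨⟨hpath.concat hqp hd, ?_⟩, ?_⟩
    · rw [SimpleGraph.Walk.support_concat]
      simp [hq'p, hqq.ne']
    · rw [SimpleGraph.Walk.edges_cons, SimpleGraph.Walk.edges_concat, List.concat_eq_append]
      intro hmem
      simp only [List.mem_cons, List.mem_append, List.not_mem_nil, or_false] at hmem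
      rcases hmem with h | h | h
      · rcases Sym2.eq_iff.1 h with ⟨h1, -⟩ | ⟨h1, -⟩
        · exact hqq.ne h1
        · exact hqp (h1 ▸ p.start_mem_support)
      · exact hqp (p.fst_mem_support_of_mem_edges h)
      · rcases Sym2.eq_iff.1 h with ⟨h1, -⟩ | ⟨-, h1⟩
        · exact hqp (h1 ▸ p.end_mem_support)
        · exact hq'p (h1 ▸ p.end_mem_support)
  obtain ⟨x, hx, y, hy, hxy, he⟩ := hG _ _ hc (by
    rw [SimpleGraph.Walk.length_cons, SimpleGraph.Walk.length_cons,
      SimpleGraph.Walk.length_concat]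
    omega)
  simp only [SimpleGraph.Walk.support_cons, SimpleGraph.Walk.support_concat,
    SimpleGraph.Walk.edges_cons, SimpleGraph.Walk.edges_concat, List.concat_eq_append,
    List.mem_cons, List.mem_append, List.not_mem_nil, or_false, not_or] at hx hy he
  obtain ⟨he1, he2, he3, he4⟩ := he
  -- the edges at `q` and `q'` that end on the path are edges of the cycle
  have hqy : ∀ z ∈ p.support, G.Adj z q → s(z, q) = s(d, q) := fun z hz h => by rw [hq z hz h]
  have hqy' : ∀ z ∈ p.support, G.Adj z q' → s(z, q') = s(q', a) := fun z hz h => by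
    rw [hq' z hz h, Sym2.eq_swap]
  have hxp : x = q ∨ x = q' ∨ x ∈ p.support := by tauto
  have hyp : y = q ∨ y = q' ∨ y ∈ p.support := by tauto
  rcases hxp with rfl | rfl | hxp <;> rcases hyp with rfl | rfl | hyp
  · exact hxy.ne rfl
  · exact he1 rfl
  · exact he4 (by rw [Sym2.eq_swap]; exact hqy y hyp hxy.symm)
  · exact he1 Sym2.eq_swap
  · exact hxy.ne rfl
  · exact he2 (by rw [Sym2.eq_swap]; exact hqy' y hyp hxy.symm)
  · exact he4 (hqy x hxp hxy)
  · exact he2 (hqy' x hxp hxy)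
  · obtain ⟨r, hr, hsub⟩ := p.exists_shorter_of_isChord hxp hyp hxy he3
    have := hshort r ha hd hsub
    omega

/-- Each connected set `C` outside a clique `Q` contains a vertex adjacent to all the members of `Q`
that have a neighbour in `C`. A vertex with the most neighbours in `Q` will do: otherwise walk from it
to the first vertex with a new neighbour in `Q`, and apply `not_walk_of_adj`. -/
theorem exists_dominating (hG : IsChordal G) {Q : Finset (Fin n)}
    (hQ : G.IsClique (Q : Set (Fin n))) {S : Set (Fin n)} (hSQ : ∀ x ∈ S, x ∉ Q)
    (C : (G.induce S).ConnectedComponent) :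
    ∃ c : S, (G.induce S).connectedComponentMk c = C ∧
      ∀ d : S, (G.induce S).connectedComponentMk d = C → ∀ q ∈ Q, G.Adj d q → G.Adj c q := by
  classical
  let N : S → Finset (Fin n) := fun x => Q.filter fun q => G.Adj x q
  obtain ⟨c0, hc0⟩ := C.exists_rep
  obtain ⟨c, hcC, hmax⟩ := Set.exists_max_image
    {x : S | (G.induce S).connectedComponentMk x = C} (fun x => (N x).card)
    (Set.toFinite _) ⟨c0, hc0⟩
  refine ⟨c, hcC, ?_⟩
  by_contra! hcon
  have hex : ∃ (k : ℕ) (e : S) (w : (G.induce S).Walk c e), w.length = k ∧ ¬ N e ⊆ N c := by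
    obtain ⟨d, hd, q, hqQ, hdq, hcq⟩ := hcon
    obtain ⟨w⟩ := SimpleGraph.ConnectedComponent.exact (hcC.trans hd.symm)
    refine ⟨_, d, w, rfl, fun hsub => hcq ?_⟩
    exact (Finset.mem_filter.1 (hsub (Finset.mem_filter.2 ⟨hqQ, hdq⟩))).2
  obtain ⟨e, w, hwk, hNe⟩ := Nat.find_spec hex
  have hbefore : ∀ z ∈ w.support, z ≠ e → N z ⊆ N c := by
    intro z hz hze
    by_contra hNz
    have h1 := Nat.find_min' hex ⟨z, w.takeUntil z hz, rfl, hNz⟩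
    have h2 := SimpleGraph.Walk.length_takeUntil_lt_length hz hze
    omega
  obtain ⟨q, hqe, hqc⟩ := Finset.not_subset.1 hNe
  have heC : (G.induce S).connectedComponentMk e = C :=
    (SimpleGraph.ConnectedComponent.sound w.reverse.reachable).trans hcC
  obtain ⟨q', hq'c, hq'e⟩ : ∃ q' ∈ N c, q' ∉ N e := by
    rw [← Finset.not_subset]
    intro hsub
    have := Finset.card_lt_card (Finset.ssubset_iff_subset_ne.2
      ⟨hsub, fun h => hqc (h ▸ hqe)⟩)
    exact absurd (hmax e heC) (by omega)
  have hqQ := (Finset.mem_filter.1 hqe).1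
  have hq'Q := (Finset.mem_filter.1 hq'c).1
  refine hG.not_walk_of_adj (q := q) (q' := q') (hQ hqQ hq'Q fun h => hqc (h ▸ hq'c))
    (w.map (SimpleGraph.Embedding.induce S).toHom)
    (Finset.mem_filter.1 hq'c).2.symm (Finset.mem_filter.1 hqe).2 ?_
  intro z hz
  rw [SimpleGraph.Walk.support_map, List.mem_map] at hz
  obtain ⟨z, hz, rfl⟩ := hz
  change (z : Fin n) ≠ q ∧ (z : Fin n) ≠ q' ∧ ¬(G.Adj z q ∧ G.Adj z q')
  refine ⟨fun h => hSQ z z.2 (h ▸ hqQ), fun h => hSQ z z.2 (h ▸ hq'Q), fun ⟨h1, h2⟩ => ?_⟩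
  by_cases hze : z = e
  · subst hze
    exact hq'e (Finset.mem_filter.2 ⟨hq'Q, h2⟩)
  · exact hqc (hbefore z hz hze (Finset.mem_filter.2 ⟨hqQ, h1⟩))

/-- Dirac's theorem, relative to a clique `Q`: the subgraph induced on `U` has a simplicial vertex
outside `Q`. -/
theorem exists_simplicial (hG : IsChordal G) {U Q : Finset (Fin n)}
    (hQ : G.IsClique (Q : Set (Fin n))) (hQU : Q ⊂ U) :
    ∃ v ∈ U, v ∉ Q ∧ G.IsClique {w | w ∈ U ∧ G.Adj v w} := by
  classical
  suffices ∀ (k : ℕ) (U Q : Finset (Fin n)), (U \ Q).card = k → G.IsClique (Q : Set (Fin n)) →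
      Q ⊂ U → ∃ v ∈ U, v ∉ Q ∧ G.IsClique {w | w ∈ U ∧ G.Adj v w} from this _ U Q rfl hQ hQU
  clear! U Q
  intro k
  induction k using Nat.strong_induction_on with
  | _ k ih =>
  intro U Q hk hQ hQU
  obtain ⟨x, hxU, hxQ⟩ := Finset.exists_of_ssubset hQU
  let S : Set (Fin n) := {z | z ∈ U ∧ z ∉ Q}
  let C := (G.induce S).connectedComponentMk ⟨x, hxU, hxQ⟩
  obtain ⟨c, hcC, hdom⟩ := hG.exists_dominating hQ (S := S) (fun z hz => hz.2) C
  -- the component of `c`, and the neighbours of this component in `Q`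
  let D : Finset (Fin n) := U.filter fun z =>
    ∃ hz : z ∈ S, (G.induce S).connectedComponentMk ⟨z, hz⟩ = C
  let N : Finset (Fin n) := Q.filter fun q => G.Adj c q
  have hcD : (c : Fin n) ∈ D := Finset.mem_filter.2 ⟨c.2.1, c.2, hcC⟩
  have hnbr : ∀ v ∈ D, ∀ w ∈ U, G.Adj v w → w ∈ D ∪ N := by
    intro v hv w hw hvw
    obtain ⟨-, hvS, hvC⟩ := Finset.mem_filter.1 hv
    by_cases hwQ : w ∈ Q
    · exact Finset.mem_union_right _ (Finset.mem_filter.2 ⟨hwQ, hdom ⟨v, hvS⟩ hvC w hwQ hvw⟩)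
    · refine Finset.mem_union_left _ (Finset.mem_filter.2 ⟨hw, ⟨hw, hwQ⟩, ?_⟩)
      rw [← hvC]
      exact SimpleGraph.ConnectedComponent.sound
        (SimpleGraph.Adj.reachable (show (G.induce S).Adj ⟨w, hw, hwQ⟩ ⟨v, hvS⟩ from hvw.symm))
  have hQ' : G.IsClique ((insert (c : Fin n) N : Finset (Fin n)) : Set (Fin n)) := by
    rw [Finset.coe_insert, SimpleGraph.isClique_insert]
    exact ⟨hQ.subset fun q hq => (Finset.mem_filter.1 hq).1,
      fun q hq _ => (Finset.mem_filter.1 hq).2⟩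
  have hsub : insert (c : Fin n) N ⊆ D ∪ N := by
    intro z hz
    rcases Finset.mem_insert.1 hz with rfl | hz
    · exact Finset.mem_union_left _ hcD
    · exact Finset.mem_union_right _ hz
  by_cases heq : insert (c : Fin n) N = D ∪ N
  · refine ⟨c, c.2.1, c.2.2, hQ'.subset fun w hw => ?_⟩
    have := hnbr c hcD w hw.1 hw.2
    rw [← heq] at this
    exact this
  · have hlt : ((D ∪ N) \ insert (c : Fin n) N).card < k := by
      rw [← hk]
      refine Finset.card_lt_card ((Finset.ssubset_iff_of_subset ?_).2
        ⟨(c : Fin n), Finset.mem_sdiff.2 c.2, by simp⟩)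
      intro z hz
      simp only [Finset.mem_sdiff, Finset.mem_union, Finset.mem_insert, not_or] at hz ⊢
      obtain ⟨-, hzS, -⟩ := Finset.mem_filter.1 (hz.1.resolve_right hz.2.2)
      exact hzS
    obtain ⟨v, hv, hvQ', hvc⟩ := ih _ hlt (D ∪ N) (insert (c : Fin n) N) rfl hQ'
      (Finset.ssubset_iff_subset_ne.2 ⟨hsub, heq⟩)
    simp only [Finset.mem_insert, not_or] at hvQ'
    have hvD : v ∈ D := (Finset.mem_union.1 hv).resolve_right hvQ'.2
    obtain ⟨hvU, hvS, -⟩ := Finset.mem_filter.1 hvD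
    refine ⟨v, hvU, hvS.2, SimpleGraph.IsClique.subset ?_ hvc⟩
    exact fun w hw => ⟨hnbr v hvD w hw.1 hw.2, hw.2⟩

/-- Chordal graphs are covered by as many cliques as an independent set has members. -/
theorem exists_cliqueCover (hG : IsChordal G) (U : Finset (Fin n)) :
    ∃ (I : Finset (Fin n)) (Q : Fin n → Finset (Fin n)), I ⊆ U ∧ G.IsIndepSet (I : Set (Fin n)) ∧
      (∀ i ∈ I, G.IsClique (Q i : Set (Fin n))) ∧ ∀ x ∈ U, ∃ i ∈ I, x ∈ Q i := by
  classical
  induction U using Finset.strongInduction with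
  | _ U ih =>
  rcases U.eq_empty_or_nonempty with rfl | hne
  · exact ⟨∅, fun _ => ∅, by simp⟩
  obtain ⟨v, hvU, -, hv⟩ := hG.exists_simplicial (U := U) (Q := ∅) (by simp)
    (Finset.empty_ssubset.2 hne)
  let U' := U.filter fun w => w ≠ v ∧ ¬ G.Adj v w
  obtain ⟨I, Q, hIU, hI, hQ, hcov⟩ := ih U' (Finset.filter_ssubset.2 ⟨v, hvU, by simp⟩)
  have hI' : ∀ i ∈ I, i ∈ U ∧ i ≠ v ∧ ¬ G.Adj v i := fun i hi => Finset.mem_filter.1 (hIU hi)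
  have hvI : v ∉ I := fun h => (hI' v h).2.1 rfl
  refine ⟨insert v I, Function.update Q v (U.filter fun w => w = v ∨ G.Adj v w), ?_, ?_, ?_, ?_⟩
  · exact Finset.insert_subset hvU fun i hi => (hI' i hi).1
  · rw [Finset.coe_insert, SimpleGraph.IsIndepSet, Set.pairwise_insert]
    exact ⟨hI, fun i hi _ => ⟨(hI' i hi).2.2, fun h => (hI' i hi).2.2 h.symm⟩⟩
  · intro i hi
    rcases Finset.mem_insert.1 hi with rfl | hi
    · rw [Function.update_self]
      have : G.IsClique (insert i {w | w ∈ U ∧ G.Adj i w}) :=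
        SimpleGraph.isClique_insert.2 ⟨hv, fun w hw _ => hw.2⟩
      refine this.subset fun w hw => ?_
      obtain ⟨hwU, hw⟩ := Finset.mem_filter.1 (Finset.mem_coe.1 hw)
      exact hw.imp id fun h => ⟨hwU, h⟩
    · rw [Function.update_of_ne (hI' i hi).2.1]
      exact hQ i hi
  · intro x hx
    by_cases hxv : x = v ∨ G.Adj v x
    · exact ⟨v, Finset.mem_insert_self _ _, by
        rw [Function.update_self]; exact Finset.mem_filter.2 ⟨hx, hxv⟩⟩
    · rw [not_or] at hxv
      obtain ⟨i, hi, hxi⟩ := hcov x (Finset.mem_filter.2 ⟨hx, hxv⟩)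
      exact ⟨i, Finset.mem_insert_of_mem hi, by rwa [Function.update_of_ne (hI' i hi).2.1]⟩

end IsChordal

variable {n : ℕ} {G : SimpleGraph (Fin n)}

/-- Maximal independent sets, the complements of the minimal vertex covers. -/
def IsMaximalIndepSet (G : SimpleGraph (Fin n)) (T : Finset (Fin n)) : Prop :=
  Maximal (fun s : Finset (Fin n) => G.IsIndepSet (s : Set (Fin n))) T

theorem exists_isMaximalIndepSet {T : Finset (Fin n)} (hT : G.IsIndepSet (T : Set (Fin n))) :
    ∃ T', T ⊆ T' ∧ IsMaximalIndepSet G T' := by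
  obtain ⟨T', h1, h2⟩ :=
    (Set.toFinite {s : Finset (Fin n) | G.IsIndepSet (s : Set (Fin n))}).exists_le_maximal hT
  exact ⟨T', h1, h2⟩

theorem IsMaximalIndepSet.isMinimalVertexCover_compl {T : Finset (Fin n)}
    (hT : IsMaximalIndepSet G T) : IsMinimalVertexCover G Tᶜ := by
  refine ⟨?_, fun C hC hCT => ?_⟩
  · change G.IsVertexCover _
    rw [Finset.coe_compl, SimpleGraph.isVertexCover_compl]
    exact hT.1
  · have h1 : G.IsIndepSet ((Cᶜ : Finset (Fin n)) : Set (Fin n)) := by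
      rw [Finset.coe_compl, SimpleGraph.isIndepSet_compl_iff_isVertexCover]
      exact hC
    have h2 := hT.2 h1 (by
      intro x hx
      rw [Finset.mem_compl]
      exact fun hxC => Finset.mem_compl.1 (hCT hxC) hx)
    intro x hx
    by_contra hxC
    exact Finset.mem_compl.1 hx (h2 (Finset.mem_compl.2 hxC))

theorem IsUnmixed.card_eq (h : IsUnmixed G) {T T' : Finset (Fin n)} (hT : IsMaximalIndepSet G T)
    (hT' : IsMaximalIndepSet G T') : T.card = T'.card := by
  have h1 := h _ _ hT.isMinimalVertexCover_compl hT'.isMinimalVertexCover_compl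
  have h2 := T.card_add_card_compl
  have h3 := T'.card_add_card_compl
  omega

/-- If a clique `Q` meets all maximal independent sets, then it is the closed neighbourhood of one of
its vertices. Otherwise each `q ∈ Q` has a neighbour outside `Q`, and choosing a dominating vertex in
each component of the complement of `Q` gives an independent set to which no member of `Q` can be
added. -/
theorem IsChordal.exists_simplicial_of_forall_isMaximalIndepSet (hG : IsChordal G)
    {Q : Finset (Fin n)} (hQ : G.IsClique (Q : Set (Fin n)))
    (hstrong : ∀ T, IsMaximalIndepSet G T → ∃ q ∈ Q, q ∈ T) :
    ∃ q ∈ Q, ∀ w, G.Adj q w → w ∈ Q := by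
  classical
  by_contra! hcon
  let S : Set (Fin n) := {x | x ∉ Q}
  choose t ht hdom using fun C => hG.exists_dominating hQ (S := S) (fun x hx => hx) C
  let T0 : Finset (Fin n) := Finset.univ.image fun C => (t C : Fin n)
  have hT0 : G.IsIndepSet (T0 : Set (Fin n)) := by
    intro x hx y hy hxy hadj
    simp only [T0, Finset.coe_image, Finset.coe_univ, Set.image_univ, Set.mem_range] at hx hy
    obtain ⟨C, rfl⟩ := hx
    obtain ⟨C', rfl⟩ := hy
    have : C = C' := by
      rw [← ht C, ← ht C']
      exact SimpleGraph.ConnectedComponent.sound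
        (SimpleGraph.Adj.reachable (show (G.induce S).Adj (t C) (t C') from hadj))
    exact hxy (by rw [this])
  obtain ⟨T, hT0T, hT⟩ := exists_isMaximalIndepSet hT0
  obtain ⟨q, hqQ, hqT⟩ := hstrong T hT
  obtain ⟨w, hqw, hwQ⟩ := hcon q hqQ
  have h1 := hdom _ ⟨w, hwQ⟩ rfl q hqQ hqw.symm
  exact hT.1 (hT0T (Finset.mem_image_of_mem _ (Finset.mem_univ _))) hqT h1.ne h1

/-- A clique that contains all neighbours of its member `q` is a facet with free vertex `q`. -/
theorem IsFacet.of_neighbors {Q : Finset (Fin n)} (hQ : G.IsClique (Q : Set (Fin n))) {q : Fin n}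
    (hq : q ∈ Q) (hN : ∀ w, G.Adj q w → w ∈ Q) : IsFacet G Q ∧ IsFreeVertex G Q q := by
  have key : ∀ F : Finset (Fin n), G.IsClique (F : Set (Fin n)) → q ∈ F → F ⊆ Q := by
    intro F hF hqF w hw
    by_cases hwq : w = q
    · rwa [hwq]
    · exact hN w (hF hqF hw (Ne.symm hwq))
  refine ⟨⟨hQ, fun F hF hQF => key F hF (hQF hq)⟩, hq, fun F hF hqF => ?_⟩
  exact (key F hF.1 hqF).antisymm (hF.2 hQ (key F hF.1 hqF))

theorem exists_isFacet {s : Finset (Fin n)} (hs : G.IsClique (s : Set (Fin n))) :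
    ∃ F, s ⊆ F ∧ IsFacet G F := by
  obtain ⟨T', h1, h2⟩ :=
    (Set.toFinite {s : Finset (Fin n) | G.IsClique (s : Set (Fin n))}).exists_le_maximal hs
  exact ⟨T', h1, h2⟩

theorem IsFreeVertex.mem_of_adj {F : Finset (Fin n)} {x y : Fin n} (hx : IsFreeVertex G F x)
    (hxy : G.Adj x y) : y ∈ F := by
  classical
  obtain ⟨F', hsub, hF'⟩ := exists_isFacet (G := G) (s := {x, y}) (by
    rw [Finset.coe_pair]
    exact SimpleGraph.isClique_pair.2 fun _ => hxy)
  rw [← hx.2 F' hF' (hsub (by simp))]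
  exact hsub (by simp)

theorem eq_of_mem_clique_of_mem_indepSet {Q T : Finset (Fin n)}
    (hQ : G.IsClique (Q : Set (Fin n))) (hT : G.IsIndepSet (T : Set (Fin n))) {x y : Fin n}
    (hxQ : x ∈ Q) (hyQ : y ∈ Q) (hxT : x ∈ T) (hyT : y ∈ T) : x = y := by
  by_contra hxy
  exact hT hxT hyT hxy (hQ hxQ hyQ hxy)

/-- If all maximal independent sets have the same size, this is the number of cliques in the clique
cover, so each of them meets every clique of the cover in exactly one vertex. -/
theorem IsChordal.freeFacets_partition (hG : IsChordal G) (hU : IsUnmixed G) :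
    (∀ x, ∃ F, x ∈ F ∧ IsFacet G F ∧ ∃ y, IsFreeVertex G F y) ∧
    ∀ F F' : Finset (Fin n), IsFacet G F → (∃ y, IsFreeVertex G F y) → IsFacet G F' →
      (∃ y, IsFreeVertex G F' y) → F ≠ F' → Disjoint F F' := by
  classical
  obtain ⟨I, Q, -, hI, hQ, hcov⟩ := hG.exists_cliqueCover Finset.univ
  choose g hgI hg using fun x => hcov x (Finset.mem_univ x)
  have hinj : ∀ T : Finset (Fin n), G.IsIndepSet (T : Set (Fin n)) → Set.InjOn g T :=
    fun T hT x hx y hy hxy => eq_of_mem_clique_of_mem_indepSet (hQ _ (hgI x)) hT (hg x)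
      (hxy ▸ hg y) hx hy
  have hmaps : ∀ T : Finset (Fin n), Set.MapsTo g T I := fun T x _ => hgI x
  have hcard : ∀ T, IsMaximalIndepSet G T → T.card = I.card := by
    intro T hT
    obtain ⟨T0, hIT0, hT0⟩ := exists_isMaximalIndepSet hI
    refine (hU.card_eq hT hT0).trans (le_antisymm ?_ (Finset.card_le_card hIT0))
    exact Finset.card_le_card_of_injOn g (hmaps T0) (hinj T0 hT0.1)
  have hmeet : ∀ T, IsMaximalIndepSet G T → ∀ i ∈ I, ∃ t ∈ T, t ∈ Q i := by
    intro T hT i hi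
    obtain ⟨t, ht, rfl⟩ := Finset.surjOn_of_injOn_of_card_le g (hmaps T) (hinj T hT.1)
      (hcard T hT).ge hi
    exact ⟨t, ht, hg t⟩
  have hsimp : ∀ i ∈ I, ∃ q, IsFacet G (Q i) ∧ IsFreeVertex G (Q i) q := by
    intro i hi
    obtain ⟨q, hq, hN⟩ := hG.exists_simplicial_of_forall_isMaximalIndepSet (hQ i hi)
      fun T hT => (hmeet T hT i hi).imp fun t ht => ⟨ht.2, ht.1⟩
    exact ⟨q, IsFacet.of_neighbors (hQ i hi) hq hN⟩
  have hfree : ∀ F, (∃ y, IsFreeVertex G F y) → ∃ i ∈ I, Q i = F := by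
    rintro F ⟨y, hy⟩
    obtain ⟨q, hq, -⟩ := hsimp (g y) (hgI y)
    exact ⟨g y, hgI y, hy.2 _ hq (hg y)⟩
  refine ⟨fun x => ?_, fun F F' _ hy _ hy' hne => ?_⟩
  · obtain ⟨q, hq, hq'⟩ := hsimp (g x) (hgI x)
    exact ⟨_, hg x, hq, q, hq'⟩
  · obtain ⟨i, hi, rfl⟩ := hfree F hy
    obtain ⟨j, hj, rfl⟩ := hfree F' hy'
    rw [Finset.disjoint_left]
    intro x hxi hxj
    obtain ⟨T, hxT, hT⟩ := exists_isMaximalIndepSet (G := G) (T := {x}) (by simp)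
    rw [Finset.singleton_subset_iff] at hxT
    -- choosing for each clique its member in `T` is a bijection, but `x` is chosen twice
    choose! h hhT hhQ using hmeet T hT
    have hsurj : Set.SurjOn h I T := fun t ht => ⟨g t, hgI t,
      eq_of_mem_clique_of_mem_indepSet (hQ _ (hgI t)) hT.1 (hhQ _ (hgI t)) (hg t)
        (hhT _ (hgI t)) ht⟩
    have hinjh := Finset.injOn_of_surjOn_of_card_le h (fun k hk => hhT k hk) hsurj (hcard T hT).ge
    refine hne (congrArg Q (hinjh hi hj ?_))
    rw [eq_of_mem_clique_of_mem_indepSet (hQ i hi) hT.1 (hhQ i hi) hxi (hhT i hi) hxT,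
      eq_of_mem_clique_of_mem_indepSet (hQ j hj) hT.1 (hhQ j hj) hxj (hhT j hj) hxT]

theorem exists_isSimplicialCliquePartition {n m : ℕ} {G : SimpleGraph (Fin n)}
    {F : Fin m → Finset (Fin n)}
    (hF : ∀ i, IsFacet G (F i) ∧ ∃ x, IsFreeVertex G (F i) x)
    (hdisj : Pairwise fun i j => Disjoint (F i) (F j)) (hcov : ∀ x, ∃ i, x ∈ F i) :
    ∃ (c : Fin n → Fin m) (v : Fin m → Fin n),
      IsSimplicialCliquePartition G c v ∧ ∀ x i, x ∈ F i ↔ c x = i := by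
  choose c hc using hcov
  choose v hv using fun i => (hF i).2
  have hmem : ∀ x i, x ∈ F i ↔ c x = i := by
    refine fun x i => ⟨fun hx => ?_, fun h => h ▸ hc x⟩
    by_contra hne
    exact Finset.disjoint_left.1 (hdisj hne) (hc x) hx
  refine ⟨c, v, ⟨fun i => (hmem _ _).1 (hv i).1, fun {x y} hxy hne => ?_, fun {i x} hix => ?_⟩, hmem⟩
  · exact (hF (c x)).1.1 (hc x) (hxy ▸ hc y) hne
  · exact (hmem _ _).1 ((hv i).mem_of_adj hix)

end CohenMacaulayChordal

theorem theorem2p1 (K : Type u) [Field K] (n : ℕ) (G : SimpleGraph (Fin n)) (hG : IsChordal G)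
    -- `F_1, …, F_m` are the facets that admit a free vertex, listed without repetition
    (m : ℕ) (F : Fin m → Finset (Fin n)) (hinj : Function.Injective F)
    (hF : ∀ s : Finset (Fin n), s ∈ Set.range F ↔ IsFacet G s ∧ ∃ x, IsFreeVertex G s x) :
    List.TFAE
      [IsCohenMacaulay.{v} G,
       IsCohenMacaulayOver K G,
       IsUnmixed G,
       Pairwise (fun i j => Disjoint (F i) (F j)) ∧ ∀ x : Fin n, ∃ i, x ∈ F i] ∧
    (Pairwise (fun i j => Disjoint (F i) (F j)) ∧ (∀ x : Fin n, ∃ i, x ∈ F i) →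
      RingTheory.Sequence.IsRegular (MvPolynomial (Fin n) K ⧸ edgeIdeal K G)
          (List.ofFn fun i : Fin m => ∑ j ∈ F i, (X j : MvPolynomial (Fin n) K)) ∧
        ringKrullDim (MvPolynomial (Fin n) K ⧸ edgeIdeal K G) = m) := by
  have hF' : ∀ i, IsFacet G (F i) ∧ ∃ x, IsFreeVertex G (F i) x := fun i => (hF _).1 ⟨i, rfl⟩
  refine ⟨?_, ?_⟩
  · tfae_have 1 → 3 := fun h => isUnmixed_of_isCohenMacaulayOver (h (ULift.{v} ℚ))
    tfae_have 2 → 3 := isUnmixed_of_isCohenMacaulayOver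
    tfae_have 3 → 4 := by
      intro hU
      obtain ⟨hcov, hdisj⟩ := hG.freeFacets_partition hU
      refine ⟨fun i j hij => hdisj _ _ (hF' i).1 (hF' i).2 (hF' j).1 (hF' j).2 (hinj.ne hij),
        fun x => ?_⟩
      obtain ⟨s, hxs, hs⟩ := hcov x
      obtain ⟨i, rfl⟩ := (hF s).2 hs
      exact ⟨i, hxs⟩
    tfae_have 4 → 1 := by
      rintro ⟨hdisj, hcov⟩ k _
      obtain ⟨c, v, h, -⟩ := exists_isSimplicialCliquePartition hF' hdisj hcov
      exact h.isCohenMacaulayRing k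
    tfae_have 4 → 2 := by
      rintro ⟨hdisj, hcov⟩
      obtain ⟨c, v, h, -⟩ := exists_isSimplicialCliquePartition hF' hdisj hcov
      exact h.isCohenMacaulayRing K
    tfae_finish
  · rintro ⟨hdisj, hcov⟩
    obtain ⟨c, v, h, hmem⟩ := exists_isSimplicialCliquePartition hF' hdisj hcov
    have hlin : (fun i : Fin m => ∑ j ∈ F i, (X j : MvPolynomial (Fin n) K)) =
        IsSimplicialCliquePartition.linearForm K c := by
      funext i
      exact Finset.sum_congr (by ext j; simp [hmem]) fun _ _ => rfl
    rw [hlin]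
    exact ⟨h.isRegular_linearForm K, h.ringKrullDim_eq K⟩
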